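/- An increasing tree on $[n]$ is a rooted (non-plane) tree with vertex set $\{0,1,\ldots,n\}$ and root $0$ in which the labels of the vertices are increasing along any path from the root. The degree of a vertex is the number of its children. A 0-1-2 increasing tree is an increasing tree in which every vertex has degree at most two. For such a tree $T$, let $\ell(T)$ be the number of its leaves (vertices of degree $0$) and let $u(T)$ be the number of its vertices of degree $1$. For $n\geqslant 1$, the André polynomial is $$E_n(x,y)=\sum_{T\in\mathcal{E}_n}x^{\ell(T)}y^{u(T)}\in\mathbb{Z}[x,y],$$ where $\mathcal{E}_n$ is the set of 0-1-2 increasing trees on $[n-1]$. For $k\geqslant 1$, define $$e_{2k-1}(x,y)=(-1)^{k-1}y(2x-y^2)^{k-1},\qquad e_{2k}(x,y)=(-1)^{k-1}(x-y^2)(2x-y^2)^{k-1}.$$ **Theorem.** For every $n\geqslant 1$, the André polynomial $E_{n+1}(x,y)$ equals the lower Hessenberg determinant of order $n$ $$E_{n+1}(x,y)=\det\bigl(h_{ij}\bigr)_{1\leqslant i,j\leqslant n},\qquad h_{ij}=\begin{cases} x\,e_i(x,y), & j=1,\\ \binom{i}{j-1}e_{i-j+1}(x,y), & 2\leqslant j\leqslant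 i,\\ -\binom{i}{i}=-1, & j=i+1,\\ 0, & j>i+1. \end{cases}$$ -/

import Mathlib

noncomputable section

/-- The tree `G` on the vertex set `{0, 1, …, n}`, rooted at `0`, is increasing: the labels of the
vertices increase along any path from the root. -/
def IsIncreasingTree {n : ℕ} (G : SimpleGraph (Fin (n + 1))) : Prop :=
  G.IsTree ∧ ∀ (v : Fin (n + 1)) (p : G.Walk 0 v), p.IsPath → p.support.Pairwise (· < ·)

/-- The children of the vertex `v` in the tree `G` rooted at `0`: the neighbours `w` of `v` such
that `v` lies on the path from the root to `w`. -/
def treeChildren {n : ℕ} (G : SimpleGraph (Fin (n + 1))) (v : Fin (n + 1)) : Set (Fin (n + 1)) :=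
  {w | G.Adj v w ∧ ∀ p : G.Walk 0 w, p.IsPath → v ∈ p.support}

/-- The degree of a vertex of a rooted tree is the number of its children. -/
def treeDegree {n : ℕ} (G : SimpleGraph (Fin (n + 1))) (v : Fin (n + 1)) : ℕ :=
  (treeChildren G v).ncard

/-- The 0-1-2 increasing trees on `[n]`, with vertex set `{0, 1, …, n}` and root `0`. -/
def zeroOneTwoTrees (n : ℕ) : Set (SimpleGraph (Fin (n + 1))) :=
  {G | IsIncreasingTree G ∧ ∀ v, treeDegree G v ≤ 2}

/-- The number of leaves, i.e. of vertices without children. -/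
def numLeaves {n : ℕ} (G : SimpleGraph (Fin (n + 1))) : ℕ :=
  {v | treeDegree G v = 0}.ncard

/-- The number of vertices with exactly one child. -/
def numDegreeOne {n : ℕ} (G : SimpleGraph (Fin (n + 1))) : ℕ :=
  {v | treeDegree G v = 1}.ncard

/-- The indeterminate `x` of `ℤ[x, y]`. -/
abbrev polyX : MvPolynomial (Fin 2) ℤ := MvPolynomial.X 0

/-- The indeterminate `y` of `ℤ[x, y]`. -/
abbrev polyY : MvPolynomial (Fin 2) ℤ := MvPolynomial.X 1

/-- The André polynomial `E_n(x, y)`. For `n ≥ 1` it is the sum of `x ^ ℓ(T) * y ^ u(T)` over the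
0-1-2 increasing trees `T` on `[n - 1]`; the convention for `n = 0` is `E_0(x, y) = y`. -/
def andrePolynomial : ℕ → MvPolynomial (Fin 2) ℤ
  | 0 => polyY
  | n + 1 => ∑ T ∈ (zeroOneTwoTrees n).toFinite.toFinset,
      polyX ^ numLeaves T * polyY ^ numDegreeOne T

/-- The polynomials `e_n(x, y)`, `n ≥ 1`. For `n = 2k - 1` and for `n = 2k` with `k ≥ 1`, the
exponent `(n - 1) / 2` is `k - 1`. (The value at `n = 0` has no meaning.) -/
def andreE (n : ℕ) : MvPolynomial (Fin 2) ℤ :=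
  if Odd n then
    (-1) ^ ((n - 1) / 2) * polyY * (2 * polyX - polyY ^ 2) ^ ((n - 1) / 2)
  else
    (-1) ^ ((n - 1) / 2) * (polyX - polyY ^ 2) * (2 * polyX - polyY ^ 2) ^ ((n - 1) / 2)

/-- The `n × n` lower Hessenberg matrix. With rows and columns numbered from `1`, as `r = i + 1`
and `c = j + 1`, its `(r, c)` entry is `x * e_r` for `c = 1`, `binom(r, c - 1) * e_{r - c + 1}` for
`2 ≤ c ≤ r`, `-binom(r, r)` for `c = r + 1`, and `0` for `c > r + 1`. -/
def andreHessenberg (n : ℕ) : Matrix (Fin n) (Fin n) (MvPolynomial (Fin 2) ℤ) :=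
  Matrix.of fun i j =>
    if (j : ℕ) = 0 then polyX * andreE (i + 1)
    else if (j : ℕ) ≤ i then (Nat.choose (i + 1) j : MvPolynomial (Fin 2) ℤ) * andreE (i - j + 1)
    else if (j : ℕ) = i + 1 then -(Nat.choose (i + 1) (i + 1) : MvPolynomial (Fin 2) ℤ)
    else 0

end

/-! Both sides equal `D^n x`, where `D` is the derivation with `D x = x * y` and `D y = x`. Trees:
give a vertex of degree 0, 1, 2 the weight x, y, 1. Hanging a new largest leaf on a vertex moves its
weight one step along x, y, 1, 0 and contributes a factor x, which is what `D` does to that weight;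
by Leibniz, `D` grows a tree in all possible ways (`parentSum_succ`). Determinant: `e_n = -x * D^n
(1/x)` for n ≥ 1, so Leibniz applied to `D^n (x * (1/x)) = 0` gives a binomial recurrence for `D^n
x` with coefficients `e_k` (`iterate_andreDeriv_eq_sum`). The Hessenberg determinant solves this
recurrence. -/

/-! ### The derivation and the polynomials `e_n` -/

/-- The derivation `x y ∂/∂x + x ∂/∂y` of `ℤ[x, y]`. -/
noncomputable def andreDeriv : Derivation ℤ (MvPolynomial (Fin 2) ℤ) (MvPolynomial (Fin 2) ℤ) :=
  MvPolynomial.mkDerivation ℤ ![polyX * polyY, polyX]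

theorem andreDeriv_polyX : andreDeriv polyX = polyX * polyY := by
  simp [andreDeriv, polyX, MvPolynomial.mkDerivation_X]

theorem andreDeriv_polyY : andreDeriv polyY = polyX := by
  simp [andreDeriv, polyY, MvPolynomial.mkDerivation_X]

theorem andreDeriv_invariant : andreDeriv (2 * polyX - polyY ^ 2) = 0 := by
  have h2 : andreDeriv (2 : MvPolynomial (Fin 2) ℤ) = 0 := by
    exact_mod_cast andreDeriv.map_natCast 2
  rw [map_sub, Derivation.leibniz, Derivation.leibniz_pow, andreDeriv_polyX, andreDeriv_polyY, h2]
  simp only [smul_eq_mul, nsmul_eq_mul]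
  push_cast
  ring

theorem andreDeriv_mul_pow (m : ℕ) (a : MvPolynomial (Fin 2) ℤ) :
    andreDeriv ((-1) ^ m * a * (2 * polyX - polyY ^ 2) ^ m) =
      (-1) ^ m * andreDeriv a * (2 * polyX - polyY ^ 2) ^ m := by
  have h1 : andreDeriv ((-1 : MvPolynomial (Fin 2) ℤ)) = 0 := by simp
  rw [Derivation.leibniz, Derivation.leibniz, Derivation.leibniz_pow, Derivation.leibniz_pow,
    andreDeriv_invariant, h1]
  simp only [smul_eq_mul, mul_zero, smul_zero, zero_add, add_zero]
  ring

/-- The polynomials `e_n` extended by `e_0 = -1`. -/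
noncomputable def andreEExt (n : ℕ) : MvPolynomial (Fin 2) ℤ := if n = 0 then -1 else andreE n

theorem andreE_odd (m : ℕ) :
    andreE (2 * m + 1) = (-1) ^ m * polyY * (2 * polyX - polyY ^ 2) ^ m := by
  have h : (2 * m + 1 - 1) / 2 = m := by omega
  rw [andreE, if_pos (by simp), h]

theorem andreE_even (m : ℕ) :
    andreE (2 * m + 2) = (-1) ^ m * (polyX - polyY ^ 2) * (2 * polyX - polyY ^ 2) ^ m := by
  have h : (2 * m + 2 - 1) / 2 = m := by omega
  rw [andreE, if_neg (by simp [parity_simps]), h]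

/-- This is the recurrence satisfied by `-x * D^n (1/x)`, which avoids fractions. The powers of `2x
- y^2` are constants for `D`, so only the factors `y` and `x - y^2` are differentiated. -/
theorem andreEExt_succ (n : ℕ) :
    andreEExt (n + 1) = andreDeriv (andreEExt n) - polyY * andreEExt n := by
  obtain ⟨m, rfl | rfl⟩ := Nat.even_or_odd' n
  · rcases m with _ | m
    · have := andreE_odd 0
      simp [andreEExt] at this ⊢
      exact this
    · rw [andreEExt, if_neg (by omega), andreEExt, if_neg (by omega), andreE_odd,
        show 2 * (m + 1) = 2 * m + 2 by ring, andreE_even, andreDeriv_mul_pow, map_sub,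
        Derivation.leibniz_pow, andreDeriv_polyX, andreDeriv_polyY]
      simp only [smul_eq_mul, nsmul_eq_mul]
      push_cast
      ring
  · rw [andreEExt, if_neg (by omega), andreEExt, if_neg (by omega), andreE_odd,
      show 2 * m + 1 + 1 = 2 * m + 2 by ring, andreE_even, andreDeriv_mul_pow, andreDeriv_polyY]
    ring

/-- The product rule for the iterates of `andreDeriv` on `x` and the polynomials `e_n`, which
are, up to the factor `-x`, its iterates on `1 / x`. -/
theorem sum_choose_mul_iterate_andreDeriv (n : ℕ) :
    ∑ p ∈ Finset.HasAntidiagonal.antidiagonal (n + 1),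
      ((n + 1).choose p.1 : MvPolynomial (Fin 2) ℤ) *
        (andreDeriv^[p.1] polyX * andreEExt p.2) = 0 := by
  set S : ℕ → MvPolynomial (Fin 2) ℤ := fun n => ∑ p ∈ Finset.HasAntidiagonal.antidiagonal n,
    (n.choose p.1 : MvPolynomial (Fin 2) ℤ) * (andreDeriv^[p.1] polyX * andreEExt p.2) with hS
  have hstep (n : ℕ) : S (n + 1) = andreDeriv (S n) - polyY * S n := by
    simp only [hS]
    rw [Finset.sum_antidiagonal_choose_succ_mul (fun i j => andreDeriv^[i] polyX * andreEExt j),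
      map_sum, Finset.mul_sum, ← Finset.sum_add_distrib, ← Finset.sum_sub_distrib]
    refine Finset.sum_congr rfl fun p hp => ?_
    have hc : n.choose p.2 = n.choose p.1 := by
      rw [Finset.HasAntidiagonal.mem_antidiagonal] at hp
      exact (Nat.choose_symm_of_eq_add (by omega)).symm
    rw [hc, andreEExt_succ, Function.iterate_succ_apply', Derivation.leibniz, Derivation.leibniz,
      Derivation.map_natCast]
    simp only [smul_eq_mul]
    ring
  -- The recurrence propagates zero only from index 1 on, since `S 0 = -x`.
  change S (n + 1) = 0
  induction n with
  | zero =>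
    rw [hstep]
    simp [hS, andreEExt, andreDeriv_polyX]
    ring
  | succ n ih => rw [hstep, ih]; simp

theorem iterate_andreDeriv_eq_sum (n : ℕ) :
    andreDeriv^[n + 1] polyX = ∑ i ∈ Finset.range (n + 1),
      ((n + 1).choose i : MvPolynomial (Fin 2) ℤ) *
        (andreDeriv^[i] polyX * andreE (n - i + 1)) := by
  have h := sum_choose_mul_iterate_andreDeriv n
  rw [Finset.Nat.sum_antidiagonal_eq_sum_range_succ_mk, Finset.sum_range_succ] at h
  have h2 : ∀ i ∈ Finset.range (n + 1), ((n + 1).choose i : MvPolynomial (Fin 2) ℤ) *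
        (andreDeriv^[i] polyX * andreEExt (n + 1 - i)) = ((n + 1).choose i) *
        (andreDeriv^[i] polyX * andreE (n - i + 1)) := by
    intro i hi
    rw [Finset.mem_range] at hi
    rw [andreEExt, if_neg (by omega), show n + 1 - i = n - i + 1 by omega]
  dsimp only at h
  rw [Finset.sum_congr rfl h2] at h
  simp only [Nat.choose_self, Nat.cast_one, one_mul, Nat.sub_self, andreEExt, if_true] at h
  linear_combination -h

/-! ### The Hessenberg determinant -/

/-- The Hessenberg matrix maps the vector `(1, E_2, …, E_{n+1})` to `(0, …, 0, E_{n+2})`. -/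
theorem andreHessenberg_mulVec (n : ℕ) (i : Fin (n + 1)) :
    ∑ j : Fin (n + 1), (if (j : ℕ) = 0 then 1 else andreDeriv^[j] polyX) *
      andreHessenberg (n + 1) i j = if (i : ℕ) = n then andreDeriv^[n + 1] polyX else 0 := by
  set g : ℕ → MvPolynomial (Fin 2) ℤ := fun j => (if j = 0 then 1 else andreDeriv^[j] polyX) *
    (if j = 0 then polyX * andreE (i + 1)
    else if j ≤ i then (Nat.choose (i + 1) j : MvPolynomial (Fin 2) ℤ) * andreE (i - j + 1)
    else if j = i + 1 then -(Nat.choose (i + 1) (i + 1) : MvPolynomial (Fin 2) ℤ)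
    else 0) with hg
  have hsum : ∑ j ∈ Finset.range (i + 1), g j = andreDeriv^[(i : ℕ) + 1] polyX := by
    rw [iterate_andreDeriv_eq_sum]
    refine Finset.sum_congr rfl fun j hj => ?_
    rw [Finset.mem_range] at hj
    rcases Nat.eq_zero_or_pos j with rfl | h
    · simp [hg]
    · simp only [hg, if_neg h.ne', if_pos (show j ≤ i by omega)]
      ring
  have hzero : ∀ j, (i : ℕ) + 1 < j → g j = 0 := by
    intro j hj
    simp only [hg, if_neg (show j ≠ 0 by omega), if_neg (show ¬ j ≤ i by omega),
      if_neg (show j ≠ i + 1 by omega), mul_zero]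
  change ∑ j : Fin (n + 1), g j = _
  rw [Fin.sum_univ_eq_sum_range g]
  -- The superdiagonal term j = i + 1 cancels the sum over j ≤ i, except in the last row, where it
  -- falls outside the matrix.
  split_ifs with hi
  · rw [← hi, hsum]
  · rw [← Finset.sum_subset (s₁ := Finset.range (i + 2)), Finset.sum_range_succ, hsum]
    · simp [hg]
    · intro j
      simp only [Finset.mem_range]
      omega
    · intro j _ hj
      simp only [Finset.mem_range, not_lt] at hj
      exact hzero j (by omega)

/-- Column 0 has coefficient 1 in the column combination, so replacing it by that combination
preserves the determinant. Only its last entry survives; the remaining minor is triangular with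
diagonal -1, and its sign cancels the cofactor sign. -/
theorem det_andreHessenberg (n : ℕ) :
    (andreHessenberg (n + 1)).det = andreDeriv^[n + 1] polyX := by
  have h := Matrix.det_updateCol_sum (andreHessenberg (n + 1)) 0
    (fun j : Fin (n + 1) => if (j : ℕ) = 0 then 1 else andreDeriv^[j] polyX)
  simp only [smul_eq_mul, andreHessenberg_mulVec] at h
  simp only [Fin.val_zero, if_true, one_mul] at h
  rw [← h, Matrix.det_succ_column_zero, Finset.sum_eq_single (Fin.last n)]
  · have htri : ((((andreHessenberg (n + 1)).updateCol 0 fun i =>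
        if (i : ℕ) = n then andreDeriv^[n + 1] polyX else 0)).submatrix
        (Fin.last n).succAbove Fin.succ).det = (-1) ^ n := by
      rw [Matrix.det_of_isLowerTriangular]
      · simp [andreHessenberg]
      · intro i j hij
        have hij' : (i : ℕ) < j := hij
        simp [andreHessenberg]
        rw [if_neg (by omega), if_neg (by omega)]
    rw [htri]
    simp [mul_right_comm, ← mul_pow]
  · intro i _ hi
    have : (i : ℕ) ≠ n := fun h => hi (Fin.ext h)
    simp [this]
  · simp

/-! ### Increasing trees through unique smaller neighbours -/

open SimpleGraph in
theorem le_of_mem_path_support {n : ℕ} {G : SimpleGraph (Fin (n + 1))} {u v : Fin (n + 1)}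
    {p : G.Walk u v} (hs : p.support.Pairwise (· < ·)) {a : Fin (n + 1)} (ha : a ∈ p.support) :
    a ≤ v := by
  have hn := p.support_ne_nil
  rw [← List.dropLast_append_getLast hn, List.pairwise_append] at hs
  rw [← List.dropLast_append_getLast hn, List.mem_append] at ha
  rcases ha with ha | ha
  · have := hs.2.2 a ha _ (List.mem_singleton_self _)
    rw [Walk.getLast_support] at this
    exact this.le
  · rw [List.mem_singleton, Walk.getLast_support] at ha
    exact ha.le

open SimpleGraph in
/-- In a graph where each nonzero vertex has at most one smaller neighbour, the labels increase
along paths that start at `0`. -/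
theorem path_support_increasing {n : ℕ} {G : SimpleGraph (Fin (n + 1))}
    (hG : ∀ v w w', G.Adj w v → w < v → G.Adj w' v → w' < v → w = w')
    {u v : Fin (n + 1)} (p : G.Walk u v) (hu : u = 0) (hp : p.IsPath) :
    p.support.Pairwise (· < ·) := by
  induction p using Walk.concatRec with
  | Hnil => simp
  | @Hconcat u v w p h ih =>
    rw [Walk.concat_isPath_iff] at hp
    have hs := ih hu hp.1
    have hle : ∀ a ∈ p.support, a ≤ v := fun a ha => le_of_mem_path_support hs ha
    have hvw : v < w := by
      -- Otherwise `w` and the penultimate vertex of `p` are both smaller neighbours of `v`, so `w`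
      -- already lies on `p`.
      by_contra hlt
      have hlt : w < v := lt_of_le_of_ne (not_lt.mp hlt) h.ne'
      have hnil : ¬ p.Nil := by
        intro hnil
        have := hnil.eq
        subst this
        subst hu
        exact absurd hlt (Fin.not_lt_zero w)
      have hpen := Walk.adj_penultimate hnil
      have hmem : p.penultimate ∈ p.support := by simp
      have := hG v w _ h.symm hlt hpen (lt_of_le_of_ne (hle _ hmem) hpen.ne)
      exact hp.2 (this ▸ hmem)
    rw [Walk.support_concat, List.pairwise_append]
    refine ⟨hs, by simp, ?_⟩
    intro a ha b hb
    rw [List.mem_singleton] at hb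
    subst hb
    exact (hle a ha).trans_lt hvw

open SimpleGraph in
theorem IsIncreasingTree.existsUnique_smaller {n : ℕ} {G : SimpleGraph (Fin (n + 1))}
    (hG : IsIncreasingTree G) {v : Fin (n + 1)} (hv : v ≠ 0) : ∃! w, w < v ∧ G.Adj w v := by
  obtain ⟨p, hp, hu⟩ := hG.1.existsUnique_path 0 v
  have hnil : ¬ p.Nil := Walk.not_nil_of_ne hv.symm
  have hadj := Walk.adj_penultimate hnil
  refine ⟨p.penultimate, ⟨lt_of_le_of_ne
    (le_of_mem_path_support (hG.2 v p hp) (by simp)) hadj.ne, hadj⟩, ?_⟩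
  rintro w ⟨hwv, hw⟩
  obtain ⟨q, hq, -⟩ := hG.1.existsUnique_path 0 w
  have hqv : v ∉ q.support := fun h => (le_of_mem_path_support (hG.2 w q hq) h).not_gt hwv
  have := hu (q.concat hw) (hq.concat hqv hw)
  rw [← this, Walk.penultimate_concat]

-- Descending through smaller neighbours reaches 0, so the graph is connected. Each edge is
-- determined by its larger endpoint, which is nonzero, so there are at most n edges.
open SimpleGraph in
theorem isIncreasingTree_of_existsUnique_smaller {n : ℕ} {G : SimpleGraph (Fin (n + 1))}
    (hG : ∀ v ≠ 0, ∃! w, w < v ∧ G.Adj w v) : IsIncreasingTree G := by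
  have huniq : ∀ v w w', G.Adj w v → w < v → G.Adj w' v → w' < v → w = w' := by
    intro v w w' h1 h2 h3 h4
    exact (hG v (Fin.pos_iff_ne_zero.mp ((Fin.zero_le w).trans_lt h2))).unique ⟨h2, h1⟩ ⟨h4, h3⟩
  refine ⟨?_, fun v p hp => path_support_increasing huniq p rfl hp⟩
  have hreach : ∀ v, G.Reachable 0 v := by
    intro v
    induction v using WellFoundedLT.induction with
    | ind v ih =>
      by_cases hv : v = 0
      · rw [hv]
      · obtain ⟨w, ⟨hw, hadj⟩, -⟩ := hG v hv
        exact (ih w hw).trans hadj.reachable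
  have hconn : G.Connected :=
    { preconnected := fun u v => (hreach u).symm.trans (hreach v)
      nonempty := inferInstance }
  rw [isTree_iff_connected_and_card]
  refine ⟨hconn, le_antisymm ?_ hconn.card_vert_le_card_edgeSet_add_one⟩
  choose! par hpar using fun v hv => (hG v hv).exists
  have hsub : G.edgeSet ⊆ (fun v => s(par v, v)) '' {v | v ≠ 0} := by
    intro e
    induction e using Sym2.ind with
    | h a b =>
      intro hab
      rw [mem_edgeSet] at hab
      have key : ∀ a b, G.Adj a b → a < b → b ≠ 0 ∧ s(par b, b) = s(a, b) := by
        intro a b hab hlt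
        have hb : b ≠ 0 := Fin.pos_iff_ne_zero.mp ((Fin.zero_le a).trans_lt hlt)
        refine ⟨hb, ?_⟩
        rw [huniq b a (par b) hab hlt (hpar b hb).2 (hpar b hb).1]
      rcases lt_or_gt_of_ne hab.ne with h | h
      · exact ⟨b, key a b hab h⟩
      · exact ⟨a, (key b a hab.symm h).1, (key b a hab.symm h).2.trans Sym2.eq_swap⟩
  have h1 := Set.ncard_le_ncard hsub (Set.toFinite _)
  have h2 := h1.trans (Set.ncard_image_le (Set.toFinite _))
  have h3 : ({v | v ≠ 0} : Set (Fin (n + 1))).ncard = n := by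
    rw [show ({v | v ≠ 0} : Set (Fin (n + 1))) = {0}ᶜ from rfl, Set.ncard_compl]
    simp
  rw [h3] at h2
  rw [Nat.card_coe_set_eq]
  simpa using h2

open SimpleGraph in
theorem IsIncreasingTree.treeChildren_eq {n : ℕ} {G : SimpleGraph (Fin (n + 1))}
    (hG : IsIncreasingTree G) (v : Fin (n + 1)) : treeChildren G v = {w | v < w ∧ G.Adj v w} := by
  ext w
  obtain ⟨p, hp, hu⟩ := hG.1.existsUnique_path 0 w
  constructor
  · rintro ⟨hadj, h⟩
    exact ⟨lt_of_le_of_ne (le_of_mem_path_support (hG.2 w p hp) (h p hp)) hadj.ne, hadj⟩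
  · rintro ⟨hlt, hadj⟩
    refine ⟨hadj, fun r hr => ?_⟩
    obtain ⟨q, hq, -⟩ := hG.1.existsUnique_path 0 v
    have hqv : w ∉ q.support := fun h => (le_of_mem_path_support (hG.2 v q hq) h).not_gt hlt
    rw [hu r hr, ← hu (q.concat hadj) (hq.concat hqv hadj), Walk.support_concat]
    simp

/-! ### Trees as parent functions -/

/-- The increasing tree in which the parent of the vertex `i + 1` is `f i`. -/
def treeOfParents {n : ℕ} (f : ∀ i : Fin n, Fin (i + 1)) : SimpleGraph (Fin (n + 1)) where
  Adj a b := (∃ i : Fin n, (a : ℕ) = f i ∧ b = i.succ) ∨ (∃ i : Fin n, (b : ℕ) = f i ∧ a = i.succ)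
  symm := ⟨fun _ _ h => h.symm⟩
  loopless := ⟨by
    rintro a (⟨i, h, rfl⟩ | ⟨i, h, rfl⟩) <;>
    · have := (f i).isLt
      rw [Fin.val_succ] at h
      omega⟩

theorem treeOfParents_adj_of_lt {n : ℕ} (f : ∀ i : Fin n, Fin (i + 1)) {a b : Fin (n + 1)} :
    a < b ∧ (treeOfParents f).Adj a b ↔ ∃ i : Fin n, (a : ℕ) = f i ∧ b = i.succ := by
  constructor
  · rintro ⟨hab, h | ⟨i, h, rfl⟩⟩
    · exact h
    · have := (f i).isLt
      rw [Fin.lt_def, Fin.val_succ] at hab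
      omega
  · rintro ⟨i, h, rfl⟩
    refine ⟨?_, Or.inl ⟨i, h, rfl⟩⟩
    have := (f i).isLt
    rw [Fin.lt_def, Fin.val_succ]
    omega

theorem isIncreasingTree_treeOfParents {n : ℕ} (f : ∀ i : Fin n, Fin (i + 1)) :
    IsIncreasingTree (treeOfParents f) := by
  refine isIncreasingTree_of_existsUnique_smaller fun v hv => ?_
  obtain ⟨i, rfl⟩ := Fin.exists_succ_eq.mpr hv
  simp only [treeOfParents_adj_of_lt, Fin.succ_inj]
  refine ⟨⟨f i, by omega⟩, ⟨i, rfl, rfl⟩, ?_⟩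
  rintro w ⟨j, hw, rfl⟩
  exact Fin.ext hw

theorem treeOfParents_injective (n : ℕ) :
    Function.Injective (treeOfParents : (∀ i : Fin n, Fin (i + 1)) → _) := by
  intro f g hfg
  funext i
  have h1 := (treeOfParents_adj_of_lt f (a := ⟨f i, by omega⟩)).mpr ⟨i, rfl, rfl⟩
  rw [hfg, treeOfParents_adj_of_lt] at h1
  obtain ⟨j, hj, hij⟩ := h1
  rw [Fin.succ_inj] at hij
  subst hij
  exact Fin.ext hj

theorem IsIncreasingTree.exists_treeOfParents {n : ℕ} {G : SimpleGraph (Fin (n + 1))}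
    (hG : IsIncreasingTree G) : ∃ f, treeOfParents f = G := by
  choose par hpar hpu using fun i : Fin n => hG.existsUnique_smaller (Fin.succ_ne_zero i)
  have hlt (i : Fin n) : (par i : ℕ) < i + 1 := by
    have := (hpar i).1
    rwa [Fin.lt_def, Fin.val_succ] at this
  refine ⟨fun i => ⟨par i, hlt i⟩, ?_⟩
  have key : ∀ a b, a < b → ((treeOfParents fun i => ⟨par i, hlt i⟩).Adj a b ↔ G.Adj a b) := by
    intro a b hab
    have h1 : (treeOfParents fun i => ⟨par i, hlt i⟩).Adj a b ↔
        ∃ i : Fin n, (a : ℕ) = par i ∧ b = i.succ := by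
      have h := treeOfParents_adj_of_lt (fun i => ⟨par i, hlt i⟩) (a := a) (b := b)
      rwa [and_iff_right hab] at h
    rw [h1]
    constructor
    · rintro ⟨i, h, rfl⟩
      rw [Fin.ext h]
      exact (hpar i).2
    · intro h
      obtain ⟨i, rfl⟩ := Fin.exists_succ_eq.mpr
        (Fin.pos_iff_ne_zero.mp ((Fin.zero_le a).trans_lt hab))
      exact ⟨i, congrArg _ (hpu i a ⟨hab, h⟩), rfl⟩
  ext a b
  rcases lt_trichotomy a b with h | rfl | h
  · exact key a b h
  · simp
  · rw [SimpleGraph.adj_comm, key b a h, SimpleGraph.adj_comm]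

/-- The number of vertices whose parent is `v`. -/
def parentCount {n : ℕ} (f : ∀ i : Fin n, Fin (i + 1)) (v : ℕ) : ℕ :=
  ∑ i, if (f i : ℕ) = v then 1 else 0

theorem treeDegree_treeOfParents {n : ℕ} (f : ∀ i : Fin n, Fin (i + 1)) (v : Fin (n + 1)) :
    treeDegree (treeOfParents f) v = parentCount f v := by
  rw [treeDegree, (isIncreasingTree_treeOfParents f).treeChildren_eq, parentCount,
    ← Finset.card_filter, ← Set.ncard_coe_finset, ← Set.ncard_image_of_injective _
    (Fin.succ_injective n)]
  congr 1
  ext w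
  simp only [Set.mem_ofPred_eq, treeOfParents_adj_of_lt, Finset.coe_filter, Finset.mem_univ,
    true_and, Set.mem_image]
  exact ⟨fun ⟨i, h, hw⟩ => ⟨i, h.symm, hw.symm⟩, fun ⟨i, h, hw⟩ => ⟨i, h.symm, hw.symm⟩⟩

/-! ### Weights and growth of trees -/

/-- The weight of a vertex with `d` children. -/
noncomputable def degreeWeight (d : ℕ) : MvPolynomial (Fin 2) ℤ :=
  if d = 0 then polyX else if d = 1 then polyY else if d = 2 then 1 else 0

/-- Weight 0 for d ≥ 3 matches `D 1 = 0`, so the degree bound needs no separate treatment. -/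
theorem andreDeriv_degreeWeight (d : ℕ) :
    andreDeriv (degreeWeight d) = polyX * degreeWeight (d + 1) := by
  rcases d with _ | _ | _ | d
  · simp [degreeWeight, andreDeriv_polyX]
  · simp [degreeWeight, andreDeriv_polyY]
  · simp [degreeWeight]
  · simp [degreeWeight]

theorem andreDeriv_prod_degreeWeight {ι : Type*} [DecidableEq ι] (s : Finset ι) (d : ι → ℕ) :
    andreDeriv (∏ v ∈ s, degreeWeight (d v)) =
      ∑ w ∈ s, polyX * ∏ v ∈ s, degreeWeight (d v + if w = v then 1 else 0) := by
  induction s using Finset.induction_on with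
  | empty => simp
  | insert a s ha ih =>
    rw [Finset.prod_insert ha, Derivation.leibniz, ih, andreDeriv_degreeWeight,
      Finset.sum_insert ha, Finset.prod_insert ha, if_pos rfl]
    have h1 : ∏ v ∈ s, degreeWeight (d v + if a = v then 1 else 0) =
        ∏ v ∈ s, degreeWeight (d v) := by
      refine Finset.prod_congr rfl fun v hv => ?_
      rw [if_neg (by rintro rfl; exact ha hv), add_zero]
    have h2 : ∑ w ∈ s, polyX * ∏ v ∈ insert a s, degreeWeight (d v + if w = v then 1 else 0) =
        degreeWeight (d a) *
          ∑ w ∈ s, polyX * ∏ v ∈ s, degreeWeight (d v + if w = v then 1 else 0) := by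
      rw [Finset.mul_sum]
      refine Finset.sum_congr rfl fun w hw => ?_
      rw [Finset.prod_insert ha, if_neg (by rintro rfl; exact ha hw), add_zero]
      ring
    rw [h1, h2]
    simp only [smul_eq_mul]
    ring

theorem prod_degreeWeight {ι : Type*} [Fintype ι] (d : ι → ℕ) (hd : ∀ v, d v ≤ 2) :
    ∏ v, degreeWeight (d v) =
      polyX ^ {v | d v = 0}.ncard * polyY ^ {v | d v = 1}.ncard := by
  classical
  have h (k : ℕ) : {v | d v = k}.ncard = ({v | d v = k} : Finset ι).card := by
    rw [← Set.ncard_coe_finset]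
    simp
  rw [h, h, ← Finset.prod_const, ← Finset.prod_const, Finset.prod_filter, Finset.prod_filter,
    ← Finset.prod_mul_distrib]
  refine Finset.prod_congr rfl fun v _ => ?_
  have := hd v
  rw [degreeWeight]
  interval_cases d v <;> simp

/-- The weighted enumerator of increasing trees in terms of parent functions. -/
noncomputable def parentSum (n : ℕ) : MvPolynomial (Fin 2) ℤ :=
  ∑ f : ∀ i : Fin n, Fin (i + 1), ∏ v : Fin (n + 1), degreeWeight (parentCount f v)

theorem andrePolynomial_succ_eq_parentSum (n : ℕ) : andrePolynomial (n + 1) = parentSum n := by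
  symm
  rw [andrePolynomial, parentSum]
  have hdeg (f : ∀ i : Fin n, Fin (i + 1)) : ∏ v : Fin (n + 1), degreeWeight (parentCount f v) =
      ∏ v : Fin (n + 1), degreeWeight (treeDegree (treeOfParents f) v) := by
    simp only [treeDegree_treeOfParents]
  simp only [hdeg]
  -- Parent functions giving some vertex three or more children contribute zero.
  rw [← Finset.sum_filter_of_ne (p := fun f => ∀ v, treeDegree (treeOfParents f) v ≤ 2)]
  · refine Finset.sum_of_injOn treeOfParents (treeOfParents_injective n).injOn ?_ ?_ ?_
    · intro f hf
      simp only [Finset.coe_filter, Finset.mem_univ, true_and, Set.mem_ofPred_eq] at hf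
      simp only [Set.Finite.coe_toFinset]
      exact ⟨isIncreasingTree_treeOfParents f, hf⟩
    · intro G hG hne
      rw [Set.Finite.mem_toFinset] at hG
      obtain ⟨f, rfl⟩ := hG.1.exists_treeOfParents
      exact absurd ⟨f, by simpa using hG.2, rfl⟩ hne
    · intro f hf
      rw [Finset.mem_filter] at hf
      exact prod_degreeWeight _ hf.2
  · intro f _ hne v
    by_contra hv
    refine hne (Finset.prod_eq_zero (Finset.mem_univ v) ?_)
    rw [degreeWeight, if_neg (by omega), if_neg (by omega), if_neg (by omega)]

theorem parentCount_eq_zero {n : ℕ} (f : ∀ i : Fin n, Fin (i + 1)) {v : ℕ} (hv : n ≤ v) :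
    parentCount f v = 0 := by
  refine Finset.sum_eq_zero fun i _ => if_neg ?_
  have := (f i).isLt
  omega

/-- A parent function for n + 1 is one for n together with the parent `w` of the new vertex; `w` is
also the factor hit by the Leibniz rule. -/
theorem parentSum_succ (n : ℕ) : parentSum (n + 1) = andreDeriv (parentSum n) := by
  rw [parentSum, parentSum, map_sum,
    ← (Fin.snocEquiv fun i : Fin (n + 1) => Fin (i + 1)).sum_comp, Fintype.sum_prod_type_right]
  refine Finset.sum_congr rfl fun f _ => ?_
  rw [andreDeriv_prod_degreeWeight]
  refine Finset.sum_congr rfl fun w _ => ?_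
  have hc (v : ℕ) : parentCount (Fin.snocEquiv (fun i : Fin (n + 1) => Fin (i + 1)) (w, f)) v =
      parentCount f v + if (w : ℕ) = v then 1 else 0 := by
    rw [parentCount, Fin.sum_univ_castSucc, parentCount]
    simp [Fin.snocEquiv]
  -- The new vertex is a leaf and supplies the factor x.
  rw [Fin.prod_univ_castSucc, mul_comm]
  simp only [hc]
  congr 1
  · rw [parentCount_eq_zero _ (by simp), if_neg (by simpa using w.isLt.ne)]
    simp [degreeWeight]
  · refine Finset.prod_congr rfl fun v _ => ?_
    simp [Fin.ext_iff]

theorem andrePolynomial_succ (n : ℕ) : andrePolynomial (n + 1) = andreDeriv^[n] polyX := by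
  rw [andrePolynomial_succ_eq_parentSum]
  induction n with
  | zero => simp [parentSum, parentCount, degreeWeight]
  | succ n ih => rw [parentSum_succ, ih, Function.iterate_succ_apply']

theorem mainTheorem5 (n : ℕ) (hn : 1 ≤ n) :
    andrePolynomial (n + 1) = (andreHessenberg n).det := by
  obtain ⟨m, rfl⟩ := Nat.exists_eq_add_of_le' hn
  rw [det_andreHessenberg, andrePolynomial_succ]
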